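/- Let $\sigma=13425$. A $k$-cluster of length $n$ with respect to $\sigma$ is a permutation $\pi$ of length $n\ge 5$ that contains precisely $k$ consecutive occurrences of $\sigma$ (five adjacent entries of $\pi$ in the same relative order as $\sigma$), such that every element of $\pi$ is part of at least one occurrence, and any two successive occurrences overlap by at least one element. Let $s_{n,k}$ be the number of $k$-clusters of length $n$, with the additional convention $s_{1,0}=1$; let $t_n=\sum_k s_{n,k}(-1)^k$, and let $T(x)=1+\sum_{n} t_n x^n$ be the cluster generating function for the pattern $13425$. For $x>0$ put $$F(x)=\frac{2}{\sqrt{3x}}\,\sinh\!\left(\frac13\,\operatorname{arcsinh}\!\left(\frac{3\sqrt{3x^3}}{2}\right)\right).$$ Then: (a) For all sufficiently small $x>0$, $F(x)$ is the sum of a power series $\Phi$ in $x$ with rational coefficients, and $$T(x)=\frac{1+2x-F(x)}{1+x-F(x)},$$ both as an identity of formal power series over $\mathbb Q$ (with $F$ replaced by its expansion $\Phi$) and as an identity of functions for all sufficiently small $x>0$, where $1+x-F(x)\ne0$ and the series $T(x)$ converges. (b) $T$ is algebraic over $\mathbb Z[x]$; it is a root of a cubic polynomial with coefficients in $\mathbb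 Z[x]$, namely $$(1+2x+6x^2+12x^3+8x^4)-(3+5x+15x^2+24x^3+12x^4)\,T+(3+4x+12x^2+15x^3+6x^4)\,T^2-(1+x+3x^2+3x^3+x^4)\,T^3=0 .$$ -/

import Mathlib

open PowerSeries

/-- The permutation `π` (in one-line notation) has an occurrence of the consecutive pattern `σ`
at the adjacent positions `i, i + 1, …, i + m - 1` (positions are counted from `0`). -/
def IsOccurrence {m n : ℕ} (σ : Equiv.Perm (Fin m)) (π : Equiv.Perm (Fin n)) (i : ℕ) : Prop :=
  ∃ h : i + m ≤ n, ∀ a b : Fin m,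
    π ⟨i + a, by omega⟩ < π ⟨i + b, by omega⟩ ↔ σ a < σ b

/-- `π` is a `k`-cluster of length `n` with respect to the consecutive pattern `σ` of length `m`:
it has length `n ≥ m`, it contains precisely `k` occurrences of `σ`, every element of `π` is part
of an occurrence of `σ`, and any two successive occurrences overlap by at least one element. -/
structure IsCluster {m n : ℕ} (σ : Equiv.Perm (Fin m)) (k : ℕ) (π : Equiv.Perm (Fin n)) :
    Prop where
  length_le : m ≤ n
  card_occurrences : {i : ℕ | IsOccurrence σ π i}.ncard = k
  covered : ∀ p : Fin n, ∃ i : ℕ, IsOccurrence σ π i ∧ i ≤ p ∧ (p : ℕ) < i + m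
  overlap : ∀ i j : ℕ, IsOccurrence σ π i → IsOccurrence σ π j → i < j →
    (∀ l : ℕ, i < l → l < j → ¬ IsOccurrence σ π l) → j < i + m

/-- The number `s_{n,k}` of `k`-clusters of length `n`, with the additional value
`s_{1,0} = 1`. -/
noncomputable def clusterCount {m : ℕ} (σ : Equiv.Perm (Fin m)) (n k : ℕ) : ℕ :=
  if n = 1 ∧ k = 0 then 1 else Nat.card {π : Equiv.Perm (Fin n) // IsCluster σ k π}

/-- `t_n = ∑_k s_{n,k} (-1)^k`. A permutation of length `n` has at most `n + 1` candidate
positions for an occurrence (at most `n` if the pattern is nonempty), so `k ≤ n` suffices. -/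
noncomputable def signedClusterCount {m : ℕ} (σ : Equiv.Perm (Fin m)) (n : ℕ) : ℤ :=
  ∑ k ∈ Finset.range (n + 1), (clusterCount σ n k : ℤ) * (-1) ^ k

/-- The cluster generating function `T(x) = 1 + ∑_n t_n x^n`, a formal power series. -/
noncomputable def clusterGF {m : ℕ} (σ : Equiv.Perm (Fin m)) : ℚ⟦X⟧ :=
  1 + PowerSeries.mk fun n => (signedClusterCount σ n : ℚ)

/-- The pattern `13425`, as the permutation `0 ↦ 0, 1 ↦ 2, 2 ↦ 3, 3 ↦ 1, 4 ↦ 4`. -/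
def pattern13425 : Equiv.Perm (Fin 5) where
  toFun := ![0, 2, 3, 1, 4]
  invFun := ![0, 3, 1, 2, 4]
  left_inv := by decide
  right_inv := by decide

/-- `F(x) = (2 / √(3x)) sinh((1/3) arcsinh(3 √(3x³) / 2))`, for real `x > 0`. -/
noncomputable def F13425 (x : ℝ) : ℝ :=
  2 / √(3 * x) * Real.sinh (1 / 3 * Real.arsinh (3 * √(3 * x ^ 3) / 2))

/-- The cubic in `T` (the outer variable) with coefficients in `ℤ[x]` (the inner variable). -/
noncomputable def cubic13425 : Polynomial (Polynomial ℤ) :=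
  let x : Polynomial ℤ := Polynomial.X
  let T : Polynomial (Polynomial ℤ) := Polynomial.X
  Polynomial.C (1 + 2 * x + 6 * x ^ 2 + 12 * x ^ 3 + 8 * x ^ 4)
    - Polynomial.C (3 + 5 * x + 15 * x ^ 2 + 24 * x ^ 3 + 12 * x ^ 4) * T
    + Polynomial.C (3 + 4 * x + 12 * x ^ 2 + 15 * x ^ 3 + 6 * x ^ 4) * T ^ 2
    - Polynomial.C (1 + x + 3 * x ^ 2 + 3 * x ^ 3 + x ^ 4) * T ^ 3

/-! Occurrences of 13425 never start at distance 1 or 2 (`OccursAt.add_three_le`), so successive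
ones in a cluster start at distance 3 or 4. In a maximal run with all distances 3, starting at
position s, the values at s, s + 3, s + 6, … increase, the values at the other positions increase
from left to right, and the last position carries the largest value. A distance 4 starts a new run
at that position.

Insert the values in increasing order. Each new value goes either to the fourth position of the next
occurrence or to the least empty position, so one bit per value determines the cluster. For positive
height, the height counts the empty positions in the occurrences begun so far; height 0 means that a
run has just been completed. Beginning an occurrence adds 2 empty positions, or 3 at height 0, and
filling the least empty position removes one. Thus k-clusters of length m + 1 correspond to walks of
m steps from 0 to 0 with k up-steps (`card_clusters`), and t_{m+1} is the signed number of these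
walks (`signedClusterCount_eq`).

Let Φ be the signed first-passage series from 1 to 0. A down-step lowers the height by only 1, so
the series from h is Φ ^ h, whence Φ = X - X Φ ^ 3. Splitting a walk at its first return gives W = 1
- X Φ ^ 3 W, that is W (1 + X - Φ) = 1, and T = 1 + X W. For x > 0 the cubic for Φ has a single real
root, which the triple-angle formula for sinh identifies as F. Eliminating Φ gives the cubic for T.
-/

/-! ### Signed walks and their generating functions. -/

/-- Signed number of walks of `m` steps on `ℕ` from `h` that reach `0` for the first time at the
end; a step goes up by `2` with sign `-1`, or down by `1`. -/
def firstPassage : ℕ → ℕ → ℤ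
  | 0, h => if h = 0 then 1 else 0
  | _ + 1, 0 => 0
  | m + 1, h + 1 => -firstPassage m (h + 3) + firstPassage m h

/-- Signed number of walks of `m` steps on `ℕ` from `c` to `0`; a step goes up by `2` (by `3`
at the origin) with sign `-1`, or down by `1`. -/
def signedWalks : ℕ → ℕ → ℤ
  | 0, c => if c = 0 then 1 else 0
  | m + 1, 0 => -signedWalks m 3
  | m + 1, c + 1 => -signedWalks m (c + 3) + signedWalks m c

/-- The generating function of `firstPassage` by the number of steps. -/
noncomputable def firstPassageGF (h : ℕ) : ℚ⟦X⟧ := PowerSeries.mk fun m => (firstPassage m h : ℚ)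

/-- The generating function of `signedWalks` by the number of steps. -/
noncomputable def walkGF (c : ℕ) : ℚ⟦X⟧ := PowerSeries.mk fun m => (signedWalks m c : ℚ)

theorem firstPassageGF_zero : firstPassageGF 0 = 1 := by
  ext n
  cases n <;> simp [firstPassageGF, firstPassage, PowerSeries.coeff_one]

theorem firstPassageGF_succ (h : ℕ) :
    firstPassageGF (h + 1) = -(X * firstPassageGF (h + 3)) + X * firstPassageGF h := by
  ext n
  cases n <;> simp [firstPassageGF, firstPassage, PowerSeries.coeff_succ_X_mul]

theorem walkGF_zero : walkGF 0 = 1 - X * walkGF 3 := by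
  ext n
  cases n <;> simp [walkGF, signedWalks, PowerSeries.coeff_succ_X_mul, PowerSeries.coeff_one]

theorem walkGF_succ (c : ℕ) :
    walkGF (c + 1) = -(X * walkGF (c + 3)) + X * walkGF c := by
  ext n
  cases n <;> simp [walkGF, signedWalks, PowerSeries.coeff_succ_X_mul]

/-- Every term on the right carries a factor X, so the coefficients of degree n + 1 come from those
of degree n, and only the boundary series at 0 is free. Both factorizations below follow from this
uniqueness. -/
theorem eq_of_walk_recurrence {G H : ℕ → ℚ⟦X⟧} (h0 : G 0 = H 0)
    (hG : ∀ h, G (h + 1) = -(X * G (h + 3)) + X * G h)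
    (hH : ∀ h, H (h + 1) = -(X * H (h + 3)) + X * H h) (h : ℕ) : G h = H h := by
  ext n
  induction n generalizing h with
  | zero =>
    cases h with
    | zero => rw [h0]
    | succ h => rw [hG, hH]; simp
  | succ n ih =>
    cases h with
    | zero => rw [h0]
    | succ h => rw [hG, hH]; simp [PowerSeries.coeff_succ_X_mul, ih]

/-- A walk descends one unit at a time, so it must pass through b on its way from a + b to 0. -/
theorem firstPassageGF_add (a b : ℕ) :
    firstPassageGF (a + b) = firstPassageGF a * firstPassageGF b := by
  refine eq_of_walk_recurrence (G := fun a => firstPassageGF (a + b))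
    (H := fun a => firstPassageGF a * firstPassageGF b) ?_ (fun h => ?_) (fun h => ?_) a
  · simp [firstPassageGF_zero]
  · have := firstPassageGF_succ (h + b)
    rwa [show h + b + 1 = h + 1 + b by ring, show h + b + 3 = h + 3 + b by ring] at this
  · simp only [firstPassageGF_succ h]; ring

theorem walkGF_eq_mul (c : ℕ) : walkGF c = firstPassageGF c * walkGF 0 := by
  refine eq_of_walk_recurrence (G := walkGF) (H := fun c => firstPassageGF c * walkGF 0)
    ?_ walkGF_succ (fun h => ?_) c
  · simp [firstPassageGF_zero]
  · simp only [firstPassageGF_succ h]; ring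

theorem firstPassageGF_three : firstPassageGF 3 = firstPassageGF 1 ^ 3 := by
  rw [show 3 = 1 + 1 + 1 by rfl, firstPassageGF_add, firstPassageGF_add]; ring

theorem firstPassageGF_one_eq :
    firstPassageGF 1 = X - X * firstPassageGF 1 ^ 3 := by
  have := firstPassageGF_succ 0
  rw [zero_add, zero_add, firstPassageGF_three, firstPassageGF_zero] at this
  linear_combination this

theorem walkGF_zero_mul : walkGF 0 * (1 + X - firstPassageGF 1) = 1 := by
  have h := walkGF_zero
  rw [walkGF_eq_mul 3, firstPassageGF_three] at h
  linear_combination h - walkGF 0 * firstPassageGF_one_eq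

theorem abs_firstPassage_le (m h : ℕ) : |firstPassage m h| ≤ 2 ^ m := by
  induction m generalizing h with
  | zero => simp only [firstPassage]; split_ifs <;> simp
  | succ m ih =>
    cases h with
    | zero => simp [firstPassage]
    | succ h =>
      have h1 := abs_le.1 (ih (h + 3))
      have h2 := abs_le.1 (ih h)
      rw [firstPassage, pow_succ, abs_le]
      constructor <;> linarith

theorem abs_signedWalks_le (m c : ℕ) : |signedWalks m c| ≤ 2 ^ m := by
  induction m generalizing c with
  | zero => simp only [signedWalks]; split_ifs <;> simp
  | succ m ih =>
    cases c with
    | zero =>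
      have h1 := abs_le.1 (ih 3)
      rw [signedWalks, pow_succ, abs_le]
      constructor <;> linarith
    | succ c =>
      have h1 := abs_le.1 (ih (c + 3))
      have h2 := abs_le.1 (ih c)
      rw [signedWalks, pow_succ, abs_le]
      constructor <;> linarith

/-! ### Evaluation of rational power series at real points. -/

/-- The rational power series `A` converges absolutely at the real number `x`, with sum `a`. -/
def AbsEvalsTo (A : ℚ⟦X⟧) (x a : ℝ) : Prop :=
  Summable (fun n : ℕ => ‖((coeff n A : ℚ) : ℝ) * x ^ n‖) ∧
    HasSum (fun n : ℕ => ((coeff n A : ℚ) : ℝ) * x ^ n) a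

namespace AbsEvalsTo

variable {A B : ℚ⟦X⟧} {x a b : ℝ}

theorem unique (hA : AbsEvalsTo A x a) (hB : AbsEvalsTo A x b) : a = b := hA.2.unique hB.2

theorem add (hA : AbsEvalsTo A x a) (hB : AbsEvalsTo B x b) : AbsEvalsTo (A + B) x (a + b) := by
  have key : (fun n : ℕ => ((coeff n (A + B) : ℚ) : ℝ) * x ^ n) = fun n =>
      ((coeff n A : ℚ) : ℝ) * x ^ n + ((coeff n B : ℚ) : ℝ) * x ^ n := by
    funext n; simp [add_mul]
  refine ⟨?_, key ▸ hA.2.add hB.2⟩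
  refine Summable.of_nonneg_of_le (fun _ => norm_nonneg _) (fun n => ?_) (hA.1.add hB.1)
  rw [congrFun key n]
  exact norm_add_le _ _

theorem neg (hA : AbsEvalsTo A x a) : AbsEvalsTo (-A) x (-a) := by
  have key : (fun n : ℕ => ((coeff n (-A) : ℚ) : ℝ) * x ^ n) = fun n =>
      -(((coeff n A : ℚ) : ℝ) * x ^ n) := by
    funext n; simp
  refine ⟨?_, key ▸ hA.2.neg⟩
  simp only [congrFun key, norm_neg]
  exact hA.1

theorem sub (hA : AbsEvalsTo A x a) (hB : AbsEvalsTo B x b) : AbsEvalsTo (A - B) x (a - b) := by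
  rw [sub_eq_add_neg, sub_eq_add_neg]
  exact hA.add hB.neg

/-- The Cauchy product is the reason for carrying absolute convergence along. -/
theorem mul (hA : AbsEvalsTo A x a) (hB : AbsEvalsTo B x b) : AbsEvalsTo (A * B) x (a * b) := by
  have key : (fun n : ℕ => ((coeff n (A * B) : ℚ) : ℝ) * x ^ n) = fun n =>
      ∑ kl ∈ Finset.HasAntidiagonal.antidiagonal n, ((coeff kl.1 A : ℚ) : ℝ) * x ^ kl.1 *
        (((coeff kl.2 B : ℚ) : ℝ) * x ^ kl.2) := by
    funext n
    rw [PowerSeries.coeff_mul, Rat.cast_sum, Finset.sum_mul]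
    refine Finset.sum_congr rfl fun kl hkl => ?_
    rw [← Finset.HasAntidiagonal.mem_antidiagonal.1 hkl, pow_add]
    push_cast
    ring
  have hs := summable_norm_sum_mul_antidiagonal_of_summable_norm hA.1 hB.1
  refine ⟨by simpa only [congrFun key] using hs, ?_⟩
  rw [key, ← hA.2.tsum_eq, ← hB.2.tsum_eq,
    tsum_mul_tsum_eq_tsum_sum_antidiagonal_of_summable_norm hA.1 hB.1]
  exact hs.of_norm.hasSum

theorem of_eq_single {k : ℕ} (h : ∀ n, coeff n A = if n = k then 1 else 0) :
    AbsEvalsTo A x (x ^ k) := by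
  have h1 : ∀ n, n ≠ k → ((coeff n A : ℚ) : ℝ) * x ^ n = 0 := fun n hn => by simp [h, hn]
  refine ⟨summable_of_ne_finset_zero (s := {k}) fun n hn => ?_, ?_⟩
  · rw [h1 n (by simpa using hn), norm_zero]
  · have := hasSum_single (f := fun n : ℕ => ((coeff n A : ℚ) : ℝ) * x ^ n) k h1
    simpa [h] using this

theorem one : AbsEvalsTo 1 x 1 := by
  simpa using of_eq_single (x := x) (k := 0) fun n => PowerSeries.coeff_one n

theorem X : AbsEvalsTo X x x := by
  simpa using of_eq_single (x := x) (k := 1) fun n => PowerSeries.coeff_X n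

theorem of_abs_coeff_le (h : ∀ n, |coeff n A| ≤ 2 ^ n) (h0 : 0 < x) (hx : x < 1 / 2) :
    AbsEvalsTo A x (∑' n : ℕ, ((coeff n A : ℚ) : ℝ) * x ^ n) := by
  have hs : Summable (fun n : ℕ => ‖((coeff n A : ℚ) : ℝ) * x ^ n‖) := by
    refine Summable.of_nonneg_of_le (fun _ => norm_nonneg _) (fun n => ?_)
      (summable_geometric_of_lt_one (r := 2 * x) (by linarith) (by linarith))
    have h' : |((coeff n A : ℚ) : ℝ)| ≤ 2 ^ n := by exact_mod_cast h n
    rw [norm_mul, norm_pow, Real.norm_eq_abs, Real.norm_eq_abs, abs_of_pos h0, mul_pow]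
    gcongr
  exact ⟨hs, hs.of_norm.hasSum⟩

end AbsEvalsTo

/-! ### The closed form and the cubic equations. -/

/-- This is sinh 3θ = 4 sinh³ θ + 3 sinh θ after the substitution 2 sinh θ = F √(3x). -/
theorem F13425_cubic {x : ℝ} (hx : 0 < x) : x * F13425 x ^ 3 + F13425 x = x := by
  set θ := 1 / 3 * Real.arsinh (3 * √(3 * x ^ 3) / 2) with hθ
  have h3 : Real.sinh (3 * θ) = 3 * √(3 * x ^ 3) / 2 := by
    rw [hθ, ← mul_assoc, mul_one_div_cancel three_ne_zero, one_mul, Real.sinh_arsinh]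
  rw [Real.sinh_three_mul] at h3
  have hs : √(3 * x ^ 3) = x * √(3 * x) := by
    rw [show 3 * x ^ 3 = x ^ 2 * (3 * x) by ring, Real.sqrt_mul (by positivity),
      Real.sqrt_sq hx.le]
  have hp : 0 < √(3 * x) := Real.sqrt_pos.2 (by positivity)
  have hq : √(3 * x) ^ 2 = 3 * x := Real.sq_sqrt (by positivity)
  have hF : F13425 x * √(3 * x) = 2 * Real.sinh θ := by
    rw [F13425, ← hθ]; field_simp
  rw [hs, show Real.sinh θ = F13425 x * √(3 * x) / 2 by linarith] at h3
  have : √(3 * x) * (x * F13425 x ^ 3 + F13425 x - x) = 0 := by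
    linear_combination 2 / 3 * h3 - F13425 x ^ 3 * √(3 * x) / 3 * hq
  rcases mul_eq_zero.1 this with h | h
  · exact absurd h hp.ne'
  · linarith

theorem eq_of_cubic_eq {x a b : ℝ} (hx : 0 < x) (ha : x * a ^ 3 + a = x)
    (hb : x * b ^ 3 + b = x) : a = b := by
  have h : (a - b) * (x * (a ^ 2 + a * b + b ^ 2) + 1) = 0 := by linear_combination ha - hb
  rcases mul_eq_zero.1 h with h | h
  · linarith
  · have : 0 ≤ a ^ 2 + a * b + b ^ 2 := by nlinarith [sq_nonneg (a + b), sq_nonneg a, sq_nonneg b]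
    have := mul_nonneg hx.le this
    linarith

theorem absEvalsTo_firstPassageGF {x : ℝ} (h0 : 0 < x) (hx : x < 1 / 2) :
    AbsEvalsTo (firstPassageGF 1) x (F13425 x) := by
  have h : AbsEvalsTo (firstPassageGF 1) x _ := AbsEvalsTo.of_abs_coeff_le (fun n => by
    rw [firstPassageGF, PowerSeries.coeff_mk]; exact_mod_cast abs_firstPassage_le n 1) h0 hx
  set f := ∑' n : ℕ, ((coeff n (firstPassageGF 1) : ℚ) : ℝ) * x ^ n
  have h' := AbsEvalsTo.X.sub (AbsEvalsTo.X.mul (h.mul (h.mul h)))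
  rw [show X - X * (firstPassageGF 1 * (firstPassageGF 1 * firstPassageGF 1)) = firstPassageGF 1 by
    linear_combination -firstPassageGF_one_eq] at h'
  have hf := h.unique h'
  have hF : f = F13425 x := eq_of_cubic_eq h0 (by linarith) (F13425_cubic h0)
  rwa [hF] at h

theorem natDegree_cubic13425 : cubic13425.natDegree = 3 := by
  have h : (1 + Polynomial.X + 3 * Polynomial.X ^ 2 + 3 * Polynomial.X ^ 3 + Polynomial.X ^ 4 :
      Polynomial ℤ) ≠ 0 := fun h => by
    simpa using congrArg (Polynomial.eval 0) h
  unfold cubic13425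
  simp only
  compute_degree
  · exact fun h' => h (by linear_combination -h')
  all_goals norm_num

theorem aeval_cubic13425 {S Φ : ℚ⟦X⟧} (hΦ : Φ = X - X * Φ ^ 3) (hS : S * (1 + X - Φ) = 1) :
    Polynomial.aeval (1 + X * S) cubic13425 = 0 := by
  have e : S * (1 + X) - 1 = S * Φ := by linear_combination hS
  have hX : algebraMap (Polynomial ℤ) ℚ⟦X⟧ Polynomial.X = X := by
    simp [PowerSeries.algebraMap_apply']
  unfold cubic13425
  simp only [map_sub, map_add, map_mul, map_pow, Polynomial.aeval_C, Polynomial.aeval_X, map_one,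
    map_ofNat, hX]
  -- With S (1 + X) - 1 = S Φ, this is X ^ 3 S ^ 3 times the cubic relation for Φ, up to sign.
  trans -(X * (X * (S * (1 + X) - 1)) ^ 3 + (X * S) ^ 2 * (X * (S * (1 + X) - 1)) -
    X * (X * S) ^ 3)
  · ring
  · rw [e]
    linear_combination -(X ^ 3 * S ^ 3) * hΦ

/-! ### Walks as binary words. -/

/-- One step of a walk on `ℕ`: up by `2` (by `3` at the origin) for `true`, else down by `1`. -/
def walkStep (c : ℕ) (b : Bool) : ℕ := if b then (if c = 0 then 3 else c + 2) else c - 1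

/-- The position after `v` steps of the walk that starts at `c` and follows the word `w`. -/
def height (c : ℕ) (w : ℕ → Bool) : ℕ → ℕ
  | 0 => c
  | v + 1 => walkStep (height c w v) (w v)

/-- The first `m` letters of `w` describe a walk on `ℕ` from `c` to `0`. -/
def IsWalkToZero (c : ℕ) (w : ℕ → Bool) (m : ℕ) : Prop :=
  (∀ v < m, w v = false → height c w v ≠ 0) ∧ height c w m = 0

/-- A finite word, continued by `false`. -/
def extendWord {m : ℕ} (w : Fin m → Bool) (v : ℕ) : Bool := if h : v < m then w ⟨v, h⟩ else false

theorem extendWord_cons_zero {m : ℕ} (b : Bool) (w : Fin m → Bool) :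
    extendWord (Fin.cons b w : Fin (m + 1) → Bool) 0 = b := by
  simp only [extendWord, Nat.succ_pos, dite_true]; rfl

theorem extendWord_cons_succ {m : ℕ} (b : Bool) (w : Fin m → Bool) (v : ℕ) :
    extendWord (Fin.cons b w : Fin (m + 1) → Bool) (v + 1) = extendWord w v := by
  simp only [extendWord, Nat.add_lt_add_iff_right]; rfl

theorem height_cons {m : ℕ} (c : ℕ) (b : Bool) (w : Fin m → Bool) (v : ℕ) :
    height c (extendWord (Fin.cons b w : Fin (m + 1) → Bool)) (v + 1) =
      height (walkStep c b) (extendWord w) v := by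
  induction v with
  | zero => simp [height, extendWord_cons_zero]
  | succ v ih => rw [height, ih, extendWord_cons_succ, height]

theorem isWalkToZero_cons {m : ℕ} (c : ℕ) (b : Bool) (w : Fin m → Bool) :
    IsWalkToZero c (extendWord (Fin.cons b w : Fin (m + 1) → Bool)) (m + 1) ↔
      (b = false → c ≠ 0) ∧ IsWalkToZero (walkStep c b) (extendWord w) m := by
  rw [IsWalkToZero, IsWalkToZero, height_cons, ← and_assoc]
  refine and_congr_left fun _ => ⟨fun h => ⟨fun hb => ?_, fun v hv hw => ?_⟩, fun h v hv hw => ?_⟩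
  · exact h 0 (Nat.succ_pos _) (by rw [extendWord_cons_zero, hb])
  · rw [← height_cons]
    exact h (v + 1) (by omega) (by rw [extendWord_cons_succ, hw])
  · cases v with
    | zero => exact h.1 (by rwa [extendWord_cons_zero] at hw)
    | succ v =>
      rw [height_cons]
      exact h.2 v (by omega) (by rwa [extendWord_cons_succ] at hw)

theorem sum_word_succ {m : ℕ} (F : (Fin (m + 1) → Bool) → ℤ) :
    ∑ w, F w = ∑ w : Fin m → Bool, F (Fin.cons true w) + ∑ w : Fin m → Bool, F (Fin.cons false w) := by
  rw [← (Fin.consEquiv fun _ => Bool).sum_comp, Fintype.sum_prod_type, Fintype.sum_bool]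
  rfl

open Classical in
theorem signedWalks_eq_sum (m c : ℕ) :
    signedWalks m c = ∑ w : Fin m → Bool, if IsWalkToZero c (extendWord w) m then
      ∏ v, (if w v then (-1 : ℤ) else 1) else 0 := by
  induction m generalizing c with
  | zero => simp [signedWalks, IsWalkToZero, height]
  | succ m ih =>
    rw [sum_word_succ]
    simp only [isWalkToZero_cons, Fin.prod_univ_succ, Fin.cons_zero, Fin.cons_succ]
    cases c with
    | zero => simp [signedWalks, ih, walkStep, ← Finset.sum_neg_distrib, neg_ite]
    | succ c => simp [signedWalks, ih, walkStep, ← Finset.sum_neg_distrib, neg_ite]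

/-! A walk from `0` builds a permutation in one-line notation by inserting the values `0, 1, …`
in increasing order. At time `v` and height `c`, the value `v` has just been inserted. -/

/-- The start of the last occurrence begun so far, or its fourth position once that is filled. -/
def front (v c : ℕ) : ℕ := v + (c - 1)

/-- The least empty position. -/
def leastFree (v c : ℕ) : ℕ := front v c + 1 - (3 * (c - 1) + 1) / 2

/-- The position `x` is filled. -/
def Filled (v c x : ℕ) : Prop := x < leastFree v c ∨ x ≤ front v c ∧ x % 3 = front v c % 3

/-- The next position to be filled, according to the letter `b`. -/
def nextPos (v c : ℕ) (b : Bool) : ℕ := if b then front v c + 3 else leastFree v c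

/-- The position of each value in the permutation described by `w`. -/
def decode (w : ℕ → Bool) : ℕ → ℕ
  | 0 => 0
  | v + 1 => nextPos v (height 0 w v) (w v)

/-- This keeps the natural subtraction in `leastFree` from truncating. -/
theorem height_bound (w : ℕ → Bool) (v : ℕ) :
    (3 * (height 0 w v - 1) + 1) / 2 ≤ front v (height 0 w v) := by
  induction v with
  | zero => simp [height, front]
  | succ v ih =>
    simp only [height, walkStep, front] at ih ⊢
    split_ifs <;> omega

/-- The c - 1 empty positions below the front are the nearest ones not congruent to it modulo 3, two
in every three. Hence the rounding in `leastFree` and the split on the parity of c. -/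
theorem filled_step {v c : ℕ} {b : Bool} (hb : (3 * (c - 1) + 1) / 2 ≤ front v c)
    (hc : b = false → c ≠ 0) (x : ℕ) :
    Filled (v + 1) (walkStep c b) x ↔ Filled v c x ∨ x = nextPos v c b := by
  cases b
  · have := hc rfl
    obtain ⟨k, rfl | rfl⟩ : ∃ k, c = 2 * k + 1 ∨ c = 2 * k + 2 := ⟨(c - 1) / 2, by omega⟩
    · have e1 : (3 * (2 * k + 1 - 1) + 1) / 2 = 3 * k := by omega
      have e2 : (3 * (2 * k + 1 - 1 - 1) + 1) / 2 = 3 * k - 1 := by omega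
      simp only [Filled, leastFree, nextPos, front, walkStep] at hb ⊢
      simp only [Bool.false_eq_true, if_false, e1, e2] at hb ⊢
      cases k <;> omega
    · have e1 : (3 * (2 * k + 2 - 1) + 1) / 2 = 3 * k + 2 := by omega
      have e2 : (3 * (2 * k + 2 - 1 - 1) + 1) / 2 = 3 * k := by omega
      simp only [Filled, leastFree, nextPos, front, walkStep] at hb ⊢
      simp only [Bool.false_eq_true, if_false, e1, e2] at hb ⊢
      omega
  · simp only [Filled, leastFree, nextPos, front, walkStep, if_true] at hb ⊢
    split_ifs <;> omega

theorem not_filled_nextPos {v c : ℕ} {b : Bool} (hb : (3 * (c - 1) + 1) / 2 ≤ front v c)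
    (hc : b = false → c ≠ 0) : ¬ Filled v c (nextPos v c b) := by
  cases b
  · have := hc rfl
    simp only [Filled, leastFree, nextPos, front] at hb ⊢
    simp only [Bool.false_eq_true, if_false]
    omega
  · simp only [Filled, leastFree, nextPos, front, if_true] at hb ⊢
    omega

/-! ### From clusters to walks. -/

/-- The order relations among the values `g` at five adjacent positions which say that they form
an occurrence of `13425`. -/
def OccursAt (n : ℕ) (g : ℕ → ℕ) (i : ℕ) : Prop :=
  i + 5 ≤ n ∧ g i < g (i + 3) ∧ g (i + 3) < g (i + 1) ∧ g (i + 1) < g (i + 2) ∧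
    g (i + 2) < g (i + 4)

theorem OccursAt.add_three_le {n i j : ℕ} {g : ℕ → ℕ} (hi : OccursAt n g i) (hj : OccursAt n g j)
    (hij : i < j) : i + 3 ≤ j := by
  by_contra h
  obtain rfl | rfl : j = i + 1 ∨ j = i + 2 := by omega
  · have := hi.2; have := hj.2; simp only [add_assoc, Nat.reduceAdd] at *; omega
  · have := hi.2; have := hj.2; simp only [add_assoc, Nat.reduceAdd] at *; omega

/-- The combinatorial conditions on a cluster, for its values `g` and positions `f`. -/
structure ClusterData (n : ℕ) (g f : ℕ → ℕ) : Prop where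
  f_lt : ∀ v < n, f v < n
  g_lt : ∀ x < n, g x < n
  g_f : ∀ v < n, g (f v) = v
  f_g : ∀ x < n, f (g x) = x
  pos : 0 < n
  zero : OccursAt n g 0
  next : ∀ i, OccursAt n g i → i + 5 = n ∨ OccursAt n g (i + 3) ∨ OccursAt n g (i + 4)
  covered : ∀ x < n, ∃ i, OccursAt n g i ∧ i ≤ x ∧ x < i + 5

/-- The filled positions are those with values up to `v`, and `s` is the start of the current
maximal run of occurrences that overlap in two elements. -/
def Invariant (n : ℕ) (g : ℕ → ℕ) (v c : ℕ) : Prop :=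
  (∀ x < n, g x ≤ v ↔ Filled v c x) ∧ front v c < n ∧
  (3 * (c - 1) + 1) / 2 ≤ front v c ∧
  ∃ s ≤ front v c, s % 3 = front v c % 3 ∧ s < leastFree v c ∧
    (∀ i, s ≤ i → i < front v c → i % 3 = front v c % 3 → OccursAt n g i) ∧
    (∀ i, OccursAt n g i → i < front v c → i + 4 ≤ s ∨ i % 3 = front v c % 3) ∧
    (c = 0 ↔ s = front v c) ∧ (c = 0 → OccursAt n g (front v c) ∨ front v c + 1 = n)

theorem leastFree_spec {v c : ℕ} (hb : (3 * (c - 1) + 1) / 2 ≤ front v c) :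
    leastFree v c % 3 ≠ front v c % 3 ∧ (2 ≤ c → leastFree v c < front v c) ∧
      (c ≤ 1 → leastFree v c = front v c + 1) := by
  simp only [leastFree]
  omega

namespace ClusterData

variable {n : ℕ} {g f : ℕ → ℕ} (D : ClusterData n g f)
include D

theorem exists_occursAt_lt {x : ℕ} (hx : x < n) (h0 : x ≠ 0) :
    ∃ i, OccursAt n g i ∧ i < x ∧ x ≤ i + 4 := by
  obtain ⟨j, hj, h1, h2⟩ := D.covered (x - 1) (by omega)
  by_cases h : x ≤ j + 4
  · exact ⟨j, hj, by omega, h⟩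
  · rcases D.next j hj with h' | h' | h'
    · omega
    · exact ⟨_, h', by omega, by omega⟩
    · exact ⟨_, h', by omega, by omega⟩

/-- The position of the next value is a non-initial position of some occurrence, and the positions
of smaller values there are already filled. The third alternative is the last step of a run, which
fills its final position. -/
theorem next_move {v c : ℕ} (hv : v + 1 < n) (hI : Invariant n g v c) :
    (OccursAt n g (front v c) ∧ f (v + 1) = front v c + 3) ∨
    (2 ≤ c ∧ f (v + 1) = leastFree v c ∧ ∀ i, OccursAt n g i → i + 3 ≠ f (v + 1)) ∨
    (c = 1 ∧ f (v + 1) = front v c + 1 ∧ ¬ OccursAt n g (front v c) ∧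
      3 ≤ front v c ∧ OccursAt n g (front v c - 3)) := by
  obtain ⟨hA, hpn, hbd, s, hsp, hs3, hsq, hS1, hS2, hcs, hc0⟩ := hI
  obtain ⟨hq3, hq2, hq1⟩ := leastFree_spec hbd
  have hxn := D.f_lt _ hv
  have hgx := D.g_f _ hv
  simp only [Filled] at hA
  generalize f (v + 1) = x at *
  generalize front v c = p at *
  generalize leastFree v c = q at *
  have hx : ¬(x < q ∨ x ≤ p ∧ x % 3 = p % 3) := by rw [← hA x hxn]; omega
  have hpred : ∀ y < n, g y < g x → y < q ∨ y ≤ p ∧ y % 3 = p % 3 := fun y hy hyx =>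
    (hA y hy).1 (by omega)
  obtain ⟨i, hi, hix, hxi⟩ := D.exists_occursAt_lt hxn (by omega)
  obtain ⟨hin, h03, h31, h12, h24⟩ := hi
  have hi : OccursAt n g i := ⟨hin, h03, h31, h12, h24⟩
  have hSi := hS2 i hi
  have hno : 2 ≤ c → x = q → ∀ j, OccursAt n g j → j + 3 ≠ x := fun h2 hxq j hj hjx => by
    have := hS2 j hj
    have := hq2 h2
    omega
  obtain rfl | rfl | rfl | rfl : x = i + 1 ∨ x = i + 2 ∨ x = i + 3 ∨ x = i + 4 := by omega
  · have h3 := hpred (i + 3) (by omega) h31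
    have hc2 : 2 ≤ c := by by_contra h; have := hq1 (by omega); omega
    refine Or.inr (Or.inl ⟨hc2, ?_, hno hc2 ?_⟩) <;>
    -- At the start of the run, i + 1 is the first position after s. Otherwise the occurrence at i -
    -- 3 forces position i - 1 to be filled before i + 1.
    · by_cases his : i = s
      · omega
      · have hj := hS1 (i - 3) (by omega) (by omega) (by omega)
        have h4 := hj.2.2.2.2
        rw [show i - 3 + 4 = i + 1 by omega] at h4
        have := hpred _ (by omega) h4
        omega
  · have h1 := hpred (i + 1) (by omega) h12
    have h3 := hpred (i + 3) (by omega) (by omega)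
    have hc2 : 2 ≤ c := by by_contra h; have := hq1 (by omega); omega
    exact Or.inr (Or.inl ⟨hc2, by omega, hno hc2 (by omega)⟩)
  · have h0 := hpred i (by omega) h03
    have : i = p := by omega
    exact Or.inl ⟨this ▸ hi, by omega⟩
  · have h2 := hpred (i + 2) (by omega) h24
    have h3 := hpred (i + 3) (by omega) (by omega)
    by_cases hip : i + 3 = p
    · have hnp : ¬ OccursAt n g p := fun hp => by
        have h4 := hp.2.2.1
        have h5 := hpred (p + 3) (by have := hp.1; omega) (by rw [show i + 4 = p + 1 by omega]; exact h4)
        omega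
      have hc1 : c ≤ 1 := by by_contra h; have := hq2 (by omega); omega
      have hc00 : c ≠ 0 := fun h => by
        rcases hc0 h with h' | h'
        · exact hnp h'
        · omega
      exact Or.inr (Or.inr ⟨by omega, by omega, hnp, by omega, by rwa [← hip, Nat.add_sub_cancel]⟩)
    · have hc2 : 2 ≤ c := by by_contra h; have := hq1 (by omega); omega
      exact Or.inr (Or.inl ⟨hc2, by omega, hno hc2 (by omega)⟩)

theorem invariant_step {v c : ℕ} {b : Bool} (hv : v + 1 < n) (hI : Invariant n g v c)
    (hb : b = true ↔ ∃ i, OccursAt n g i ∧ g (i + 3) = v + 1) :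
    (b = false → c ≠ 0) ∧ f (v + 1) = nextPos v c b ∧ Invariant n g (v + 1) (walkStep c b) := by
  have hmove := D.next_move hv hI
  obtain ⟨hA, hpn, hbd, s, hsp, hs3, hsq, hS1, hS2, hcs, hc0⟩ := hI
  obtain ⟨hq3, hq2, hq1⟩ := leastFree_spec hbd
  have hxn := D.f_lt _ hv
  have hgx := D.g_f _ hv
  have hb' : b = true ↔ ∃ i, OccursAt n g i ∧ i + 3 = f (v + 1) := by
    rw [hb]
    refine exists_congr fun i => and_congr_right fun hi => ⟨fun h => ?_, fun h => ?_⟩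
    · rw [← h, D.f_g _ (by have := hi.1; omega)]
    · rw [h, hgx]
  have hb1 : (∀ i, OccursAt n g i → i + 3 ≠ f (v + 1)) → b = false := fun h => by
    by_contra h'
    obtain ⟨i, hi, hi'⟩ := hb'.1 (by simpa using h')
    exact h i hi hi'
  have hb2 := fun i hi hi' => hb'.2 ⟨i, hi, hi'⟩
  clear hb hb'
  replace hmove : (b = true ∧ OccursAt n g (front v c) ∧ f (v + 1) = front v c + 3) ∨
      (b = false ∧ 2 ≤ c ∧ f (v + 1) = leastFree v c) ∨
      (b = false ∧ c = 1 ∧ f (v + 1) = front v c + 1 ∧ ¬ OccursAt n g (front v c) ∧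
        3 ≤ front v c ∧ OccursAt n g (front v c - 3)) := by
    refine hmove.imp (fun h => ⟨hb2 _ h.1 h.2.symm, h⟩) (Or.imp (fun h => ⟨hb1 h.2.2, h.1, h.2.1⟩)
      (fun h => ⟨hb1 fun i hi hi' => ?_, h⟩))
    obtain ⟨-, h2, -, h4, h5⟩ := h
    rcases lt_trichotomy i (front v c - 3) with h | h | h
    · omega
    · omega
    · have := h5.add_three_le hi h
      omega
  clear hb1 hb2
  have hcb : b = false → c ≠ 0 := by
    rintro rfl
    rcases hmove with ⟨h, -⟩ | h | h
    · simp at h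
    · omega
    · omega
  have hpos : f (v + 1) = nextPos v c b := by
    rcases hmove with ⟨rfl, h1, h2⟩ | ⟨rfl, h1, h2⟩ | ⟨rfl, h1, h2, -⟩
    · rw [h2]; rfl
    · rw [h2]; rfl
    · rw [h2, ← hq1 (by omega)]; rfl
  refine ⟨hcb, hpos, fun x hx => ?_, ?_⟩
  · rw [filled_step hbd hcb, ← hA x hx, ← hpos]
    constructor
    · intro h
      by_cases h' : g x = v + 1
      · right; rw [← h', D.f_g x hx]
      · left; omega
    · rintro (h | rfl) <;> omega
  rcases hmove with ⟨hbt, h1, h2⟩ | ⟨rfl, h1, h2⟩ | ⟨rfl, rfl, h2, h3, h4, h5⟩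
  · have hp' : front (v + 1) (walkStep c b) = front v c + 3 := by
      simp only [walkStep, hbt, front, if_true]; split_ifs <;> omega
    have hq' : leastFree (v + 1) (walkStep c b) = leastFree v c := by
      rw [leastFree, leastFree, hp']
      simp only [walkStep, hbt, if_true]; split_ifs <;> omega
    have hc' : walkStep c b ≠ 0 := by simp only [walkStep, hbt, if_true]; split_ifs <;> omega
    have hbd' : (3 * (walkStep c b - 1) + 1) / 2 ≤ front v c + 3 := by
      simp only [walkStep, hbt, if_true]; split_ifs <;> omega
    rw [hp', hq']
    refine ⟨by omega, hbd', s, by omega, by omega, hsq, fun i hi hi' hi3 => ?_,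
      fun i hi hi' => ?_, ?_, fun h => absurd h hc'⟩
    · rcases lt_or_ge i (front v c) with h | h
      · exact hS1 i hi h (by omega)
      · rwa [show i = front v c by omega]
    · rcases lt_trichotomy i (front v c) with h | h | h
      · have := hS2 i hi h
        omega
      · omega
      · have := h1.add_three_le hi h
        omega
    · omega
  · have hc' : walkStep c false = c - 1 := rfl
    have hp' : front (v + 1) (walkStep c false) = front v c := by
      rw [hc', front, front]; omega
    have hq' : leastFree v c ≤ leastFree (v + 1) (walkStep c false) := by
      rw [leastFree, leastFree, hp', hc']; omega
    rw [hp']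
    refine ⟨hpn, by omega, s, hsp, hs3, by omega, hS1, hS2, by omega, by omega⟩
  · have hc' : walkStep 1 false = 0 := rfl
    have hp' : front (v + 1) 0 = front v 1 + 1 := by simp only [front]
    have hq' : leastFree (v + 1) 0 = front v 1 + 2 := by rw [leastFree, hp']; rfl
    rw [hc', hp', hq']
    -- The run is complete, so the new front, its last position, becomes the start s of the next
    -- run.
    refine ⟨by omega, by omega, _, le_rfl, rfl, by omega, fun i _ _ _ => by omega,
      fun i hi hi' => ?_, by omega, fun _ => ?_⟩
    · rcases lt_trichotomy i (front v 1 - 3) with h | h | h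
      · have := hi.add_three_le h5 h
        omega
      · omega
      · have := h5.add_three_le hi h
        have : i = front v 1 := by omega
        exact absurd (this ▸ hi) h3
    · rcases D.next _ h5 with h | h | h
      · omega
      · rw [show front v 1 - 3 + 3 = front v 1 by omega] at h
        exact absurd h h3
      · rw [show front v 1 - 3 + 4 = front v 1 + 1 by omega] at h
        exact Or.inl h

theorem invariant {w : ℕ → Bool}
    (hw : ∀ v, v + 1 < n → (w v = true ↔ ∃ i, OccursAt n g i ∧ g (i + 3) = v + 1))
    (v : ℕ) (hv : v < n) : Invariant n g v (height 0 w v) := by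
  induction v with
  | zero =>
    have hf : g 0 = 0 := by
      by_contra h
      have h1 := D.f_lt 0 D.pos
      have h2 := D.g_f 0 D.pos
      obtain ⟨i, hi, h3, h4⟩ := D.exists_occursAt_lt h1 (fun h' => h (by rwa [h'] at h2))
      obtain ⟨h5, h6⟩ := hi
      obtain h | h | h | h : f 0 = i + 1 ∨ f 0 = i + 2 ∨ f 0 = i + 3 ∨ f 0 = i + 4 := by omega
      all_goals rw [h] at h2; omega
    refine ⟨fun x hx => ?_, hv, by simp [height], 0, by simp [front, height], rfl,
      by simp [leastFree, front, height], fun i _ hi => ?_, fun i _ hi => ?_, by simp [front, height],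
      fun _ => Or.inl D.zero⟩
    · have : g x = 0 ↔ x = 0 := ⟨fun h => by rw [← D.f_g x hx, h]; nth_rw 1 [← hf]; exact D.f_g 0 hv, fun h => h ▸ hf⟩
      simp only [Filled, leastFree, front, height]
      omega
    · simp [front, height] at hi
    · simp [front, height] at hi
  | succ v ih => exact (D.invariant_step hv (ih (by omega)) (hw v hv)).2.2

theorem isWalkToZero {w : ℕ → Bool} {m : ℕ} (hm : n = m + 1)
    (hw : ∀ v, v + 1 < n → (w v = true ↔ ∃ i, OccursAt n g i ∧ g (i + 3) = v + 1)) :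
    IsWalkToZero 0 w m := by
  refine ⟨fun v hv => (D.invariant_step (by omega) (D.invariant hw v (by omega))
    (hw v (by omega))).1, ?_⟩
  by_contra hc
  obtain ⟨hA, hpn, hbd, s, hsp, hs3, hsq, hS1, hS2, hcs, -⟩ := D.invariant hw m (by omega)
  obtain ⟨hq3, hq2, hq1⟩ := leastFree_spec hbd
  -- After the last value no position is empty, whereas a nonzero height leaves an empty one inside
  -- an occurrence.
  have hall : ∀ x < n, Filled m (height 0 w m) x := fun x hx => (hA x hx).1 (by
    have := D.g_lt x hx; omega)
  simp only [Filled] at hall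
  generalize front m (height 0 w m) = p at *
  have hne : s ≠ p := fun h => hc (hcs.2 h)
  have h3 := hS1 (p - 3) (by omega) (by omega) (by omega)
  have := h3.1
  have := hall (p + 1) (by omega)
  have hlast := hall (n - 1) (by omega)
  rcases D.next _ h3 with h | h | h
  · have := hall (leastFree m (height 0 w m))
    omega
  · have := h.1
    have := hall (p + 3) (by omega)
    omega
  · have := h.1
    have := hall (leastFree m (height 0 w m))
    omega

theorem eq_decode {w : ℕ → Bool}
    (hw : ∀ v, v + 1 < n → (w v = true ↔ ∃ i, OccursAt n g i ∧ g (i + 3) = v + 1))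
    (v : ℕ) (hv : v < n) : f v = decode w v := by
  cases v with
  | zero =>
    have h1 := D.invariant hw 0 hv
    have h2 := (h1.1 0 hv).2 (by simp [Filled, leastFree, front, height])
    rw [decode]; nth_rw 1 [← Nat.le_zero.1 h2]; exact D.f_g 0 hv
  | succ v => exact (D.invariant_step hv (D.invariant hw v (by omega)) (hw v hv)).2.1

end ClusterData

/-! ### From walks to clusters. -/

theorem isWalkToZero_step {w : ℕ → Bool} {m v : ℕ} (hw : IsWalkToZero 0 w m) (hv : v < m) :
    (w v = true ∧ front (v + 1) (height 0 w (v + 1)) = front v (height 0 w v) + 3 ∧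
      leastFree (v + 1) (height 0 w (v + 1)) = leastFree v (height 0 w v) ∧
      height 0 w (v + 1) ≠ 0) ∨
    (w v = false ∧ 2 ≤ height 0 w v ∧ front (v + 1) (height 0 w (v + 1)) = front v (height 0 w v) ∧
      leastFree v (height 0 w v) ≤ leastFree (v + 1) (height 0 w (v + 1)) ∧
      height 0 w (v + 1) ≠ 0) ∨
    (w v = false ∧ height 0 w v = 1 ∧
      front (v + 1) (height 0 w (v + 1)) = front v (height 0 w v) + 1 ∧
      leastFree (v + 1) (height 0 w (v + 1)) = front v (height 0 w v) + 2 ∧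
      height 0 w (v + 1) = 0) := by
  have h0 := hw.1 v hv
  rw [height]
  cases hb : w v
  · have := h0 hb
    simp only [front, leastFree, walkStep, Bool.false_eq_true, if_false, false_and, false_or,
      true_and]
    omega
  · simp only [front, leastFree, walkStep, if_true, true_and]
    split_ifs <;> omega

theorem filled_iff_exists_decode {w : ℕ → Bool} {m : ℕ} (hw : IsWalkToZero 0 w m) {v : ℕ}
    (hv : v ≤ m) (x : ℕ) : Filled v (height 0 w v) x ↔ ∃ u ≤ v, decode w u = x := by
  induction v with
  | zero => simp [Filled, leastFree, front, height, decode]; omega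
  | succ v ih =>
    rw [height, filled_step (height_bound w v) (hw.1 v hv), ih (by omega)]
    constructor
    · rintro (⟨u, hu, rfl⟩ | rfl)
      · exact ⟨u, by omega, rfl⟩
      · exact ⟨v + 1, le_rfl, rfl⟩
    · rintro ⟨u, hu, rfl⟩
      rcases Nat.le_succ_iff.1 hu with h | rfl
      · exact Or.inl ⟨u, h, rfl⟩
      · exact Or.inr rfl

theorem decode_ne_of_lt {w : ℕ → Bool} {m : ℕ} (hw : IsWalkToZero 0 w m) {u v : ℕ}
    (huv : u < v) (hv : v ≤ m) : decode w u ≠ decode w v := by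
  obtain ⟨v, rfl⟩ : ∃ k, v = k + 1 := ⟨v - 1, by omega⟩
  intro h
  exact not_filled_nextPos (height_bound w v) (hw.1 v hv)
    ((filled_iff_exists_decode hw (by omega) _).2 ⟨u, by omega, h⟩)

theorem decode_lt {w : ℕ → Bool} {m : ℕ} (hw : IsWalkToZero 0 w m) {v : ℕ} (hv : v ≤ m) :
    decode w v < m + 1 := by
  have := (filled_iff_exists_decode hw le_rfl _).2 ⟨v, hv, rfl⟩
  rw [hw.2] at this
  simp only [Filled, leastFree, front] at this
  omega

/-- Induction backwards from the end of the walk: the front stays put until the next up-step, except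
that reaching height 0 moves it by one. This gives both the room for the current occurrence and the
distance to the next one. -/
theorem walk_next_occurrence {w : ℕ → Bool} {m v : ℕ} (hw : IsWalkToZero 0 w m) (hv : v ≤ m) :
    (height 0 w v = 0 → front v (height 0 w v) + 1 ≤ m + 1 ∧ (front v (height 0 w v) = m ∨
        ∃ u < m, w u = true ∧ front u (height 0 w u) = front v (height 0 w v))) ∧
    (height 0 w v ≠ 0 → front v (height 0 w v) + 2 ≤ m + 1 ∧ (front v (height 0 w v) + 1 = m ∨
        ∃ u < m, w u = true ∧ (front u (height 0 w u) = front v (height 0 w v) ∨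
          front u (height 0 w u) = front v (height 0 w v) + 1))) := by
  induction hv using Nat.decreasingInduction with
  | self => simp [hw.2, front]
  | of_succ v hv ih =>
    obtain ⟨h1, h2⟩ := ih
    rcases isWalkToZero_step hw hv with ⟨hb, hp, -, hc⟩ | ⟨hb, hc2, hp, -, hc⟩ | ⟨hb, hc1, hp, -, hc⟩
    · have := (h2 hc).1
      exact ⟨fun _ => ⟨by omega, Or.inr ⟨v, hv, hb, rfl⟩⟩,
        fun _ => ⟨by omega, Or.inr ⟨v, hv, hb, Or.inl rfl⟩⟩⟩
    · rw [hp] at h2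
      exact ⟨fun h => by omega, fun _ => h2 hc⟩
    · rw [hp] at h1
      obtain ⟨h3, h4⟩ := h1 hc
      refine ⟨fun h => by omega, fun _ => ⟨h3, h4.imp id ?_⟩⟩
      rintro ⟨u, hu, hwu, h⟩
      exact ⟨u, hu, hwu, Or.inr h⟩

/-- For an occurrence begun at p, this makes the positions p + 1, p + 2, p + 4 fill from left to
right: none is congruent to p modulo 3, so while the run lasts they are filled only as least empty
positions. -/
theorem front_or_leastFree_after {w : ℕ → Bool} {m v : ℕ} (hw : IsWalkToZero 0 w m)
    (hb : w v = true) {t : ℕ} (hvt : v + 1 ≤ t) (ht : t ≤ m) :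
    (front t (height 0 w t) % 3 = front v (height 0 w v) % 3 ∧
      front v (height 0 w v) + 3 ≤ front t (height 0 w t)) ∨
    front v (height 0 w v) + 5 ≤ leastFree t (height 0 w t) := by
  induction t, hvt using Nat.le_induction with
  | base =>
    rcases isWalkToZero_step hw ht with h | h | h
    · omega
    · simp [hb] at h
    · simp [hb] at h
  | succ t hvt ih =>
    have := ih (by omega)
    have := (leastFree_spec (height_bound w t)).2.2
    rcases isWalkToZero_step hw ht with h | h | h <;> omega

theorem front_next {w : ℕ → Bool} {m v : ℕ} (hw : IsWalkToZero 0 w m) (hv : v < m)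
    (hb : w v = true) :
    front v (height 0 w v) + 5 = m + 1 ∨ ∃ u < m, w u = true ∧
      (front u (height 0 w u) = front v (height 0 w v) + 3 ∨
        front u (height 0 w u) = front v (height 0 w v) + 4) := by
  obtain ⟨-, hp, hq, hc⟩ | h | h := isWalkToZero_step hw hv
  rotate_left
  · simp [hb] at h
  · simp [hb] at h
  have := ((walk_next_occurrence hw (v := v + 1) hv).2 hc).2
  rw [hp] at this
  exact this.imp (by omega) id

theorem first_letter {w : ℕ → Bool} {m : ℕ} (hw : IsWalkToZero 0 w m) (hm : 0 < m) :
    w 0 = true := by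
  by_contra h
  exact hw.1 0 hm (by simpa using h) rfl

theorem exists_last_front {w : ℕ → Bool} {m : ℕ} (hw : IsWalkToZero 0 w m) (hm : 0 < m) (x : ℕ) :
    ∃ v < m, w v = true ∧ front v (height 0 w v) ≤ x ∧
      ∀ u < m, w u = true → front u (height 0 w u) ≤ x →
        front u (height 0 w u) ≤ front v (height 0 w v) := by
  induction x with
  | zero =>
    exact ⟨0, hm, first_letter hw hm, by simp [front, height], fun u _ _ h => h.trans (Nat.zero_le _)⟩
  | succ x ih =>
    by_cases hx1 : ∃ u < m, w u = true ∧ front u (height 0 w u) = x + 1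
    · obtain ⟨u, hu, hwu, h⟩ := hx1
      exact ⟨u, hu, hwu, h.le, fun u' _ _ h' => h'.trans h.ge⟩
    · obtain ⟨v, hv, hb, h1, h2⟩ := ih
      refine ⟨v, hv, hb, by omega, fun u hu hwu h => h2 u hu hwu ?_⟩
      rcases Nat.le_succ_iff.1 h with h' | h'
      · exact h'
      · exact absurd ⟨u, hu, hwu, h'⟩ hx1

section Decode

variable {w : ℕ → Bool} {m : ℕ} {g : ℕ → ℕ} (hw : IsWalkToZero 0 w m)
  (hg : ∀ x < m + 1, g x < m + 1) (hgf : ∀ v < m + 1, g (decode w v) = v)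
  (hfg : ∀ x < m + 1, decode w (g x) = x)
include hw hg hgf hfg

omit hg in
theorem filled_iff_le {v x : ℕ} (hv : v ≤ m) (hx : x < m + 1) :
    Filled v (height 0 w v) x ↔ g x ≤ v := by
  rw [filled_iff_exists_decode hw hv]
  constructor
  · rintro ⟨u, hu, rfl⟩
    rwa [hgf u (by omega)]
  · exact fun h => ⟨g x, h, hfg x hx⟩

theorem occursAt_front {v : ℕ} (hv : v < m) (hb : w v = true) :
    OccursAt (m + 1) g (front v (height 0 w v)) := by
  have hF : ∀ t x, t ≤ m → x < m + 1 → (Filled t (height 0 w t) x ↔ g x ≤ t) := fun t x ht hx =>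
    filled_iff_le hw hgf hfg ht hx
  have hf : decode w (v + 1) = front v (height 0 w v) + 3 := by
    rw [decode, nextPos, hb, if_pos rfl]
  obtain ⟨-, hp, hq, hc⟩ | h | h := isWalkToZero_step hw hv
  rotate_left
  · simp [hb] at h
  · simp [hb] at h
  have hA := fun t ht ht' => front_or_leastFree_after hw hb (t := t) ht ht'
  have hlen := ((walk_next_occurrence hw (v := v + 1) hv).2 hc).1
  have hF0 := hF v
  have hF1 := hF (v + 1)
  simp only [Filled] at hF hF0 hF1
  rw [hp, hq] at hF1
  obtain ⟨hq3, hq2, hq1⟩ := leastFree_spec (height_bound w v)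
  have hinj : ∀ x y, x < m + 1 → y < m + 1 → g x = g y → x = y := fun x y hx hy h => by
    rw [← hfg x hx, h, hfg y hy]
  have h3 : g (front v (height 0 w v) + 3) = v + 1 := by rw [← hf]; exact hgf _ (by omega)
  rw [hp] at hlen
  generalize front v (height 0 w v) = p at *
  have hq : leastFree v (height 0 w v) ≤ p + 1 := by
    by_cases h : 2 ≤ height 0 w v
    · have := hq2 h; omega
    · have := hq1 (by omega); omega
  have g0 := (hF0 p hv.le (by omega)).1 (by omega)
  have g1 : ¬ g (p + 1) ≤ v + 1 := by
    rw [← hF1 (p + 1) hv (by omega)]; omega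
  have g2 : ¬ g (p + 2) ≤ v + 1 := by
    rw [← hF1 (p + 2) hv (by omega)]; omega
  have g4 : ¬ g (p + 4) ≤ v + 1 := by
    rw [← hF1 (p + 4) hv (by omega)]; omega
  have l2 := hg (p + 2) (by omega)
  have l4 := hg (p + 4) (by omega)
  refine ⟨by omega, by omega, by omega, ?_, ?_⟩
  · have h1 := (hF (g (p + 2)) (p + 2) (by omega) (by omega)).2 le_rfl
    have h2 := (hF (g (p + 2)) (p + 1) (by omega) (by omega)).1 (by
      have := hA (g (p + 2)) (by omega) (by omega)
      omega)
    refine lt_of_le_of_ne h2 fun h => ?_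
    have := hinj _ _ (by omega) (by omega) h
    omega
  · have h1 := (hF (g (p + 4)) (p + 4) (by omega) (by omega)).2 le_rfl
    have h2 := (hF (g (p + 4)) (p + 2) (by omega) (by omega)).1 (by
      have := hA (g (p + 4)) (by omega) (by omega)
      omega)
    refine lt_of_le_of_ne h2 fun h => ?_
    have := hinj _ _ (by omega) (by omega) h
    omega

theorem occursAt_iff (hm : 0 < m) (i : ℕ) :
    OccursAt (m + 1) g i ↔ ∃ v < m, w v = true ∧ front v (height 0 w v) = i := by
  constructor
  · intro hi
    obtain ⟨v, hv, hb, h1, h2⟩ := exists_last_front hw hm i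
    have ho := occursAt_front hw hg hgf hfg hv hb
    refine ⟨v, hv, hb, ?_⟩
    by_contra hne
    have h3 := ho.add_three_le hi (by omega)
    have hi1 := hi.1
    -- An occurrence strictly after the last front v would start at distance at least 3. The next
    -- front, at distance 3 or 4, then contradicts maximality or starts one position after i.
    rcases front_next hw hv hb with h | ⟨u, hu, hwu, h | h⟩
    · omega
    · have := h2 u hu hwu
      omega
    · have h4 := h2 u hu hwu
      have ho' := occursAt_front hw hg hgf hfg hu hwu
      have := hi.add_three_le ho'
      omega
  · rintro ⟨v, hv, hb, rfl⟩
    exact occursAt_front hw hg hgf hfg hv hb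

theorem clusterData_decode (hm : 0 < m) : ClusterData (m + 1) g (decode w) where
  f_lt v hv := decode_lt hw (by omega)
  g_lt := hg
  g_f := hgf
  f_g := hfg
  pos := Nat.succ_pos m
  zero := (occursAt_iff hw hg hgf hfg hm 0).2 ⟨0, hm, first_letter hw hm, by simp [front, height]⟩
  next i hi := by
    obtain ⟨v, hv, hb, rfl⟩ := (occursAt_iff hw hg hgf hfg hm i).1 hi
    rcases front_next hw hv hb with h | ⟨u, hu, hwu, h | h⟩
    · exact Or.inl h
    · exact Or.inr (Or.inl (h ▸ occursAt_front hw hg hgf hfg hu hwu))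
    · exact Or.inr (Or.inr (h ▸ occursAt_front hw hg hgf hfg hu hwu))
  covered x hx := by
    obtain ⟨v, hv, hb, h1, h2⟩ := exists_last_front hw hm x
    refine ⟨_, occursAt_front hw hg hgf hfg hv hb, h1, ?_⟩
    rcases front_next hw hv hb with h | ⟨u, hu, hwu, h⟩
    · omega
    · have := h2 u hu hwu
      omega

theorem letter_iff (hm : 0 < m) {v : ℕ} (hv : v < m) :
    w v = true ↔ ∃ i, OccursAt (m + 1) g i ∧ g (i + 3) = v + 1 := by
  have hd : ∀ u, w u = true → decode w (u + 1) = front u (height 0 w u) + 3 := fun u hu => by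
    rw [decode, nextPos, hu, if_pos rfl]
  constructor
  · intro hb
    refine ⟨_, occursAt_front hw hg hgf hfg hv hb, ?_⟩
    rw [← hd v hb]
    exact hgf _ (by omega)
  · rintro ⟨i, hi, h⟩
    obtain ⟨u, hu, hb, rfl⟩ := (occursAt_iff hw hg hgf hfg hm i).1 hi
    rw [← hd u hb, hgf _ (by omega)] at h
    rwa [← Nat.succ_injective h]

end Decode

/-! ### The bijection between clusters and walks, and the signed count. -/

/-- The value of `π` at a position, as a natural number. -/
def permValue {n : ℕ} (π : Equiv.Perm (Fin n)) (x : ℕ) : ℕ :=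
  if h : x < n then π ⟨x, h⟩ else x

theorem permValue_of_lt {n : ℕ} (π : Equiv.Perm (Fin n)) {x : ℕ} (h : x < n) :
    permValue π x = π ⟨x, h⟩ := dif_pos h

theorem isOccurrence_iff_occursAt {n : ℕ} (π : Equiv.Perm (Fin n)) (i : ℕ) :
    IsOccurrence pattern13425 π i ↔ OccursAt n (permValue π) i := by
  constructor
  · rintro ⟨h, H⟩
    refine ⟨h, ?_⟩
    rw [permValue_of_lt π (show i < n by omega), permValue_of_lt π (show i + 1 < n by omega),
      permValue_of_lt π (show i + 2 < n by omega), permValue_of_lt π (show i + 3 < n by omega),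
      permValue_of_lt π (show i + 4 < n by omega)]
    exact ⟨(H 0 3).2 (by decide), (H 3 1).2 (by decide), (H 1 2).2 (by decide),
      (H 2 4).2 (by decide)⟩
  · rintro ⟨h, h03, h31, h12, h24⟩
    refine ⟨h, fun a b => ?_⟩
    rw [permValue_of_lt π (show i < n by omega), permValue_of_lt π (show i + 3 < n by omega)] at h03
    rw [permValue_of_lt π (show i + 1 < n by omega), permValue_of_lt π (show i + 3 < n by omega)] at h31
    rw [permValue_of_lt π (show i + 1 < n by omega), permValue_of_lt π (show i + 2 < n by omega)] at h12
    rw [permValue_of_lt π (show i + 2 < n by omega), permValue_of_lt π (show i + 4 < n by omega)] at h24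
    rw [Fin.lt_def]
    fin_cases a <;> fin_cases b <;> simp [pattern13425] <;> omega

theorem IsCluster.clusterData {n k : ℕ} {π : Equiv.Perm (Fin n)} (h : IsCluster pattern13425 k π) :
    ClusterData n (permValue π) (permValue π.symm) := by
  have hn := h.length_le
  have hsymm : ∀ σ : Equiv.Perm (Fin n), ∀ x < n, permValue σ (permValue σ.symm x) = x :=
    fun σ x hx => by
      rw [permValue_of_lt _ hx, permValue_of_lt _ (Fin.is_lt _)]; simp
  have hlt : ∀ σ : Equiv.Perm (Fin n), ∀ x < n, permValue σ x < n := fun σ x hx => by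
    rw [permValue_of_lt _ hx]; exact Fin.is_lt _
  have hcov : ∀ x < n, ∃ i, OccursAt n (permValue π) i ∧ i ≤ x ∧ x < i + 5 := fun x hx => by
    obtain ⟨i, hi, h1, h2⟩ := h.covered ⟨x, hx⟩
    exact ⟨i, (isOccurrence_iff_occursAt π i).1 hi, h1, h2⟩
  refine ⟨hlt _, hlt _, hsymm π, hsymm π.symm, by omega, ?_, fun i hi => ?_, hcov⟩
  · obtain ⟨i, hi, h1, -⟩ := hcov 0 (by omega)
    rwa [Nat.le_zero.1 h1] at hi
  · by_contra hne
    push Not at hne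
    obtain ⟨hne, h3, h4⟩ := hne
    have hi1 := hi.1
    obtain ⟨j, hj, h1, h2⟩ := hcov (i + 5) (by omega)
    classical
    -- The least later occurrence is the successor of i, to which the overlap condition applies.
    have hex : ∃ j, OccursAt n (permValue π) j ∧ i < j := ⟨j, hj, by omega⟩
    obtain ⟨hl, hil⟩ := Nat.find_spec hex
    have hlt := h.overlap i (Nat.find hex) ((isOccurrence_iff_occursAt π i).2 hi)
      ((isOccurrence_iff_occursAt π _).2 hl) hil fun l h1 h2 h3 =>
        Nat.find_min hex h2 ⟨(isOccurrence_iff_occursAt π l).1 h3, h1⟩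
    have := hi.add_three_le hl hil
    obtain h | h : Nat.find hex = i + 3 ∨ Nat.find hex = i + 4 := by omega
    · exact h3 (h ▸ hl)
    · exact h4 (h ▸ hl)

theorem ClusterData.isCluster {n : ℕ} {π : Equiv.Perm (Fin n)} {f : ℕ → ℕ}
    (D : ClusterData n (permValue π) f) :
    IsCluster pattern13425 {i : ℕ | IsOccurrence pattern13425 π i}.ncard π := by
  simp only [isOccurrence_iff_occursAt]
  refine ⟨by simpa using D.zero.1, by simp only [isOccurrence_iff_occursAt], fun p => ?_,
    fun i j hi hj hij hl => ?_⟩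
  · obtain ⟨i, hi, h⟩ := D.covered p p.2
    exact ⟨i, (isOccurrence_iff_occursAt π i).2 hi, h⟩
  · rw [isOccurrence_iff_occursAt] at hi hj
    simp only [isOccurrence_iff_occursAt] at hl
    have := hi.1
    have := hj.1
    by_contra hij'
    rcases D.next i hi with h | h | h
    · omega
    · exact hl _ (by omega) (by omega) h
    · exact hl _ (by omega) (by omega) h

open Classical in
/-- The word of a permutation: the value `v + 1` is marked if it is the fourth value of an
occurrence. -/
noncomputable def wordOf {m : ℕ} (π : Equiv.Perm (Fin (m + 1))) (v : Fin m) : Bool :=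
  decide (∃ i, OccursAt (m + 1) (permValue π) i ∧ permValue π (i + 3) = v + 1)

theorem extendWord_wordOf {m : ℕ} (π : Equiv.Perm (Fin (m + 1))) (v : ℕ) (hv : v + 1 < m + 1) :
    extendWord (wordOf π) v = true ↔
      ∃ i, OccursAt (m + 1) (permValue π) i ∧ permValue π (i + 3) = v + 1 := by
  simp [extendWord, wordOf, show v < m by omega]

theorem permValue_injOn {n : ℕ} (π : Equiv.Perm (Fin n)) {x y : ℕ} (hx : x < n) (hy : y < n)
    (h : permValue π x = permValue π y) : x = y := by
  rw [permValue_of_lt π hx, permValue_of_lt π hy] at h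
  simpa using π.injective (Fin.ext h)

theorem ncard_occurrences {m : ℕ} (π : Equiv.Perm (Fin (m + 1))) :
    {i : ℕ | IsOccurrence pattern13425 π i}.ncard =
      (Finset.univ.filter fun v => wordOf π v = true).card := by
  rw [← Set.ncard_coe_finset]
  have key : ∀ v : Fin m, wordOf π v = true ↔
      ∃ i, OccursAt (m + 1) (permValue π) i ∧ permValue π (i + 3) = v + 1 := fun v => by
    simp [wordOf]
  simp only [isOccurrence_iff_occursAt]
  refine Set.ncard_congr (fun i hi => ⟨permValue π (i + 3) - 1, ?_⟩) ?_ ?_ ?_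
  · have h1 : i + 3 < m + 1 := by have := hi.1; omega
    have h2 : permValue π (i + 3) < m + 1 := by rw [permValue_of_lt π h1]; exact Fin.is_lt _
    have := hi.2.1
    omega
  · intro i hi
    have := hi.2.1
    simp only [Finset.coe_filter, Finset.mem_univ, true_and, Set.mem_ofPred_eq]
    exact (key _).2 ⟨i, hi, by simp only; omega⟩
  · intro i j hi hj h
    have h1 := hi.1
    have h2 := hj.1
    have h3 := hi.2.1
    have h4 := hj.2.1
    rw [Fin.mk.injEq] at h
    have := permValue_injOn π (x := i + 3) (y := j + 3) (by omega) (by omega) (by omega)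
    omega
  · intro v hv
    simp only [Finset.coe_filter, Finset.mem_univ, true_and, Set.mem_ofPred_eq] at hv
    obtain ⟨i, hi, h⟩ := (key v).1 hv
    exact ⟨i, hi, Fin.ext (by simp only; omega)⟩

theorem exists_perm_of_walk {m : ℕ} (hm : 0 < m) {w : ℕ → Bool} (hw : IsWalkToZero 0 w m) :
    ∃ π : Equiv.Perm (Fin (m + 1)), ClusterData (m + 1) (permValue π) (decode w) ∧
      ∀ v : Fin m, wordOf π v = w v := by
  let f : Fin (m + 1) → Fin (m + 1) := fun v => ⟨decode w v, decode_lt hw (by omega)⟩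
  have hinj : Function.Injective f := fun u v h => by
    have h' : decode w u = decode w v := congrArg Fin.val h
    rcases lt_trichotomy u v with h1 | h1 | h1
    · exact absurd h' (decode_ne_of_lt hw h1 (by omega))
    · exact h1
    · exact absurd h'.symm (decode_ne_of_lt hw h1 (by omega))
  let e : Equiv.Perm (Fin (m + 1)) := Equiv.ofBijective f (Finite.injective_iff_bijective.1 hinj)
  have he : ∀ v, (e v : ℕ) = decode w v := fun v => rfl
  have hg : ∀ x < m + 1, permValue e.symm x < m + 1 := fun x hx => by
    rw [permValue_of_lt _ hx]; exact Fin.is_lt _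
  have hgf : ∀ v < m + 1, permValue e.symm (decode w v) = v := fun v hv => by
    rw [permValue_of_lt _ (decode_lt hw (by omega)),
      show (⟨decode w v, decode_lt hw (by omega)⟩ : Fin (m + 1)) = e ⟨v, hv⟩ from rfl,
      Equiv.symm_apply_apply]
  have hfg : ∀ x < m + 1, decode w (permValue e.symm x) = x := fun x hx => by
    rw [permValue_of_lt _ hx, ← he, Equiv.apply_symm_apply]
  -- `decode` sends values to positions, so the cluster is the inverse of e.
  refine ⟨e.symm, clusterData_decode hw hg hgf hfg hm, fun v => ?_⟩
  rw [Bool.eq_iff_iff, letter_iff hw hg hgf hfg hm v.2]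
  simp [wordOf]

theorem card_clusters {m : ℕ} (hm : 0 < m) (k : ℕ) :
    Nat.card {π : Equiv.Perm (Fin (m + 1)) // IsCluster pattern13425 k π} =
      Nat.card {w : Fin m → Bool // IsWalkToZero 0 (extendWord w) m ∧
        (Finset.univ.filter fun v => w v = true).card = k} := by
  refine Nat.card_eq_of_bijective (fun π => ⟨wordOf π.1,
    π.2.clusterData.isWalkToZero rfl (extendWord_wordOf π.1),
    by rw [← ncard_occurrences, π.2.card_occurrences]⟩) ⟨fun π ρ h => ?_, fun w => ?_⟩
  · have h' : wordOf π.1 = wordOf ρ.1 := congrArg Subtype.val h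
    have h1 := π.2.clusterData.eq_decode (extendWord_wordOf π.1)
    have h2 := ρ.2.clusterData.eq_decode (extendWord_wordOf ρ.1)
    rw [h'] at h1
    have : π.1.symm = ρ.1.symm := Equiv.ext fun v => Fin.ext (by
      rw [← permValue_of_lt π.1.symm v.2, ← permValue_of_lt ρ.1.symm v.2, h1 v v.2, h2 v v.2])
    exact Subtype.ext (Equiv.symm_bijective.injective this)
  · obtain ⟨w, hw, hk⟩ := w
    obtain ⟨π, D, hπ⟩ := exists_perm_of_walk hm hw
    have hw' : wordOf π = w := funext fun v => by
      rw [hπ v]; simp [extendWord]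
    refine ⟨⟨π, ?_⟩, Subtype.ext hw'⟩
    rw [← hk, ← hw', ← ncard_occurrences]
    exact D.isCluster

open Classical in
theorem signedClusterCount_eq (m : ℕ) :
    signedClusterCount pattern13425 (m + 1) = signedWalks m 0 := by
  -- For m = 0 the convention s_{1,0} = 1 accounts for the empty walk.
  rcases Nat.eq_zero_or_pos m with rfl | hm
  · have h : ∀ k, IsEmpty {π : Equiv.Perm (Fin 1) // IsCluster pattern13425 k π} := fun k =>
      ⟨fun π => by simpa using π.2.length_le⟩
    simp [signedClusterCount, clusterCount, signedWalks]
  · rw [signedWalks_eq_sum, signedClusterCount, ← Finset.sum_filter]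
    have hprod : ∀ w : Fin m → Bool, ∏ v, (if w v then (-1 : ℤ) else 1) =
        (-1) ^ (Finset.univ.filter fun v => w v = true).card := fun w => by
      rw [Finset.prod_ite, Finset.prod_const, Finset.prod_const_one, mul_one]
    simp only [hprod]
    rw [← Finset.sum_fiberwise_of_maps_to (t := Finset.range (m + 1 + 1))
      (g := fun w : Fin m → Bool => (Finset.univ.filter fun v => w v = true).card)]
    · refine Finset.sum_congr rfl fun k _ => ?_
      rw [Finset.sum_congr rfl fun w hw => by rw [(Finset.mem_filter.1 hw).2], Finset.sum_const,
        nsmul_eq_mul, clusterCount, if_neg (by omega), card_clusters hm, Nat.card_eq_fintype_card,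
        Fintype.card_subtype, Finset.filter_filter]
    · intro w _
      have := Finset.card_filter_le (Finset.univ : Finset (Fin m)) fun v => w v = true
      rw [Finset.card_univ, Fintype.card_fin] at this
      exact Finset.mem_range.2 (by omega)

theorem signedClusterCount_zero : signedClusterCount pattern13425 0 = 0 := by
  have h : ∀ k, IsEmpty {π : Equiv.Perm (Fin 0) // IsCluster pattern13425 k π} := fun k =>
    ⟨fun π => by simpa using π.2.length_le⟩
  simp [signedClusterCount, clusterCount]

theorem clusterGF_eq : clusterGF pattern13425 = 1 + X * walkGF 0 := by
  rw [clusterGF]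
  congr 1
  ext n
  cases n with
  | zero => simp [signedClusterCount_zero]
  | succ n => simp [PowerSeries.coeff_succ_X_mul, walkGF, signedClusterCount_eq]

/-! ### Conclusion. -/

theorem mainTheorem5 :
    (∃ Φ : ℚ⟦X⟧, ∃ r : ℝ, 0 < r ∧
      (∀ x : ℝ, 0 < x → x < r →
        HasSum (fun n : ℕ => ((PowerSeries.coeff n Φ : ℚ) : ℝ) * x ^ n) (F13425 x)) ∧
      clusterGF pattern13425 = (1 + 2 * X - Φ) * (1 + X - Φ)⁻¹ ∧
      (∀ x : ℝ, 0 < x → x < r →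
        1 + x - F13425 x ≠ 0 ∧
        HasSum (fun n : ℕ => ((PowerSeries.coeff n (clusterGF pattern13425) : ℚ) : ℝ) * x ^ n)
          ((1 + 2 * x - F13425 x) / (1 + x - F13425 x)))) ∧
    cubic13425.natDegree = 3 ∧
    Polynomial.aeval (clusterGF pattern13425) cubic13425 = 0 ∧
    IsAlgebraic (Polynomial ℤ) (clusterGF pattern13425) := by
  have hG := walkGF_zero_mul
  have haeval : Polynomial.aeval (clusterGF pattern13425) cubic13425 = 0 := by
    rw [clusterGF_eq]
    exact aeval_cubic13425 firstPassageGF_one_eq hG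
  refine ⟨⟨firstPassageGF 1, 1 / 2, by norm_num, fun x h0 hx =>
    (absEvalsTo_firstPassageGF h0 hx).2, ?_, fun x h0 hx => ?_⟩, natDegree_cubic13425, haeval,
    cubic13425, ?_, haeval⟩
  · rw [PowerSeries.eq_mul_inv_iff_mul_eq, clusterGF_eq]
    · linear_combination X * hG
    · intro h
      have := congrArg (constantCoeff (R := ℚ)) hG
      rw [map_mul, h, mul_zero, map_one] at this
      exact zero_ne_one this
  · have hF := absEvalsTo_firstPassageGF h0 hx
    have hS : AbsEvalsTo (walkGF 0) x _ := AbsEvalsTo.of_abs_coeff_le (fun n => by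
      rw [walkGF, PowerSeries.coeff_mk]; exact_mod_cast abs_signedWalks_le n 0) h0 hx
    set S := ∑' n : ℕ, ((coeff n (walkGF 0) : ℚ) : ℝ) * x ^ n
    have hSD := hS.mul ((AbsEvalsTo.one.add AbsEvalsTo.X).sub hF)
    rw [hG] at hSD
    -- Evaluating W (1 + X - Φ) = 1 at x gives the nonvanishing of the denominator as well as the
    -- value of W.
    have h1 := hSD.unique AbsEvalsTo.one
    have hne : 1 + x - F13425 x ≠ 0 := right_ne_zero_of_mul_eq_one h1
    refine ⟨hne, ?_⟩
    have hT := (AbsEvalsTo.one.add (AbsEvalsTo.X.mul hS)).2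
    rw [← clusterGF_eq] at hT
    rwa [show (1 + 2 * x - F13425 x) / (1 + x - F13425 x) = 1 + x * S by
      rw [div_eq_iff hne]; linear_combination -x * h1]
  · intro h
    have := natDegree_cubic13425
    rw [h] at this
    simp at this
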